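/- Let $n\ge 3$, let $S_3$ be the symmetric group on $\{1,2,3\}$ and $D_n=\langle r,z\mid r^n=z^2=(zr)^2=1\rangle$ the dihedral group of order $2n$, and let $X_n$ be the Cayley graph of $S_3\times D_n$ with connection set $S=\{((1\,2),1),((1\,3),z),((2\,3),zr)\}$, that is, the graph with vertex set $S_3\times D_n$ and edges $\{g,gs\}$, $g\in S_3\times D_n$, $s\in S$. Definitions. For a finite simple graph $G=(V,E)$ and $k\ge 0$, a $k$-rainbow dominating function is a map $f$ from $V$ to the subsets of $\{1,\dots,k\}$ such that $\bigcup_{u\sim v}f(u)=\{1,\dots,k\}$ for every $v$ with $f(v)=\emptyset$; the $k$-rainbow domination number $\gamma_{rk}(G)$ is the minimum of $\sum_{v\in V}|f(v)|$ over all such $f$. A graph is $d$-RDR if it is $d$-regular and $\gamma_{rd}(G)=|V|/2$. A girth cycle is a cycle of length equal to the girth. The signature of a vertex $v$ is the non-decreasing sequence of the numbers of girth cycles that contain $e$, where $e$ runs over the edges incident with $v$; a regular graph has signature $\sigma$ if all its vertices have signature $\sigma$. For $1\le k\le N/2$, the generalized Petersen graph $\mathrm{GP}(N,k)$ has vertices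 $u_i,v_i$ $(i\in\mathbb Z_N)$ and edges $\{u_i,u_{i+1}\}$, $\{u_i,v_i\}$, $\{v_i,v_{i+k}\}$. Theorem. For every $n\ge3$ the graph $X_n$ is a connected vertex-transitive $3$-RDR graph of order $12n$, and the following holds. (i) $X_3$ has girth $6$ and signature $(0,1,1)$. (ii) For $n\ge4$, $X_n$ has girth $8$ and signature $(5,5,6)$; moreover $X_n\cong \mathrm{GP}(6n,2n-1)$ if $n\equiv 1\pmod 3$, and $X_n\cong \mathrm{GP}(6n,2n+1)$ if $n\equiv -1\pmod 3$. (iii) For $n\ge 3$ with $3\mid n$, $X_n$ is not isomorphic to any generalized Petersen graph $\mathrm{GP}(N,k)$, $1\le k\le N/2$. -/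

import Mathlib

namespace RainbowGraphs

section General

variable {V : Type*}

/-- A graph is vertex-transitive if its automorphism group acts transitively on the vertices. -/
def IsVertexTransitive (G : SimpleGraph V) : Prop :=
  ∀ u v : V, ∃ φ : G ≃g G, φ u = v

/-- `f` is a `k`-rainbow dominating function on `G`: it assigns to each vertex a subset of a set
of `k` colours, and all `k` colours appear in the open neighbourhood of any non-coloured vertex. -/
def IsRainbowDominating (k : ℕ) (G : SimpleGraph V) (f : V → Finset (Fin k)) : Prop :=
  ∀ v, f v = ∅ → ∀ i : Fin k, ∃ u, G.Adj v u ∧ i ∈ f u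

/-- The weight `∑ v, |f v|`. -/
def rainbowWeight [Fintype V] {k : ℕ} (f : V → Finset (Fin k)) : ℕ :=
  ∑ v, (f v).card

/-- The `k`-rainbow domination number: the minimum weight of a `k`-rainbow dominating function.
(The set is never empty: one may put all the colours on every vertex.) -/
noncomputable def rainbowDominationNumber [Fintype V] (k : ℕ) (G : SimpleGraph V) : ℕ :=
  sInf {w | ∃ f : V → Finset (Fin k), IsRainbowDominating k G f ∧ rainbowWeight f = w}

open Classical in
/-- `G` is `d`-rainbow domination regular (`d`-RDR): it is `d`-regular and its `d`-rainbow
domination number is half the number of its vertices. -/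
def IsRDR [Fintype V] (d : ℕ) (G : SimpleGraph V) : Prop :=
  G.IsRegularOfDegree d ∧ 2 * rainbowDominationNumber d G = Fintype.card V

/-- The girth cycles (the cycles of minimum length) of `G`. A cycle is represented by its set of
edges, so it is counted once, irrespective of a starting vertex and a direction. -/
def girthCycles (G : SimpleGraph V) : Set (Set (Sym2 V)) :=
  {C | ∃ (v : V) (p : G.Walk v v), p.IsCycle ∧ p.length = G.girth ∧ C = p.edgeSet}

/-- The number of girth cycles that contain the edge `e`. -/
noncomputable def girthCycleCount (G : SimpleGraph V) (e : Sym2 V) : ℕ :=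
  {C ∈ girthCycles G | e ∈ C}.ncard

open Classical in
/-- The signature of the vertex `v`: the numbers of girth cycles through the edges incident
with `v`, in non-decreasing order. -/
noncomputable def vertexSignature [Fintype V] (G : SimpleGraph V) (v : V) : List ℕ :=
  ((G.incidenceFinset v).val.map (girthCycleCount G)).sort (· ≤ ·)

open Classical in
/-- `G` is girth regular with signature `l`: it is regular and each vertex has signature `l`. -/
def HasSignature [Fintype V] (G : SimpleGraph V) (l : List ℕ) : Prop :=
  (∃ d, G.IsRegularOfDegree d) ∧ ∀ v, vertexSignature G v = l

end General

/-- The generalized Petersen graph `GP(n, k)`: the vertices `u i = inl i` and `v i = inr i`,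
`i ∈ ℤ/n`, with outer edges `{u i, u (i + 1)}`, spokes `{u i, v i}` and inner edges
`{v i, v (i + k)}`. -/
def GP (n k : ℕ) : SimpleGraph (ZMod n ⊕ ZMod n) :=
  SimpleGraph.fromRel fun x y => match x, y with
    | .inl i, .inl j => j = i + 1
    | .inl i, .inr j => j = i
    | .inr i, .inr j => j = i + (k : ZMod n)
    | .inr _, .inl _ => False

/-- The Cayley graph of `S₃ × D_n` (with `D_n` of order `2 * n`, `r = DihedralGroup.r 1` and
`z = DihedralGroup.sr 0`) for the set of the involutions `((1 2), 1)`, `((1 3), z)`,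
`((2 3), z * r)`, where the three points are numbered `0, 1, 2`. -/
def X (n : ℕ) : SimpleGraph (Equiv.Perm (Fin 3) × DihedralGroup n) :=
  SimpleGraph.mulCayley
    {(Equiv.swap 0 1, 1),
     (Equiv.swap 0 2, DihedralGroup.sr 0),
     (Equiv.swap 1 2, DihedralGroup.sr 0 * DihedralGroup.r 1)}

end RainbowGraphs

open SimpleGraph

/-! The generators are distinct involutions, so walks from a vertex of X_n are words in three
letters, closed walks are words with product 1, and trails give reduced words. A word can be
evaluated in S₃ × D_∞; then n matters only through the question whether it divides the rotation
exponent (`prod_gen_eq_one_iff`). Girths and signatures for all n thus follow from one enumeration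
of reduced words of length at most 8.

The lower bound for rainbow domination is a double count over neighbourhoods; colouring each even
permutation by its value at one point attains it.

If 3 ∤ n, the alternating products of the last two generators form a cycle of length 6n, the first
generator gives the spokes, and the inner edges are shifts by k: the permutation component of the
cycle has period 6, the dihedral one period 2n, and k is ±1 modulo 6 and ∓1 modulo 2n
(`nonempty_iso_GP`).

If 3 ∣ n, an isomorphism with GP(N, k) forces N = 6n. Rotations make all outer edges lie on equally
many girth cycles, while the counts single out the first generator, so the outer rim uses only the
last two. But such a walk stays on a translate of the graph of a map D_n → S₃, which has only 2n
vertices (`not_nonempty_iso_GP`). -/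

/-- A cycle is determined by its base point, its second vertex and its set of edges. -/
theorem SimpleGraph.Walk.IsCycle.eq_of_edgeSet_eq {V : Type*} {G : SimpleGraph V} {u : V}
    {p q : G.Walk u u} (hp : p.IsCycle) (hq : q.IsCycle) (hl : p.length = q.length)
    (he : p.edgeSet = q.edgeSet) (h1 : p.snd = q.snd) : p = q := by
  have hnb : ∀ x, p.toSubgraph.neighborSet x = q.toSubgraph.neighborSet x := by
    intro x
    ext y
    rw [Subgraph.mem_neighborSet, Subgraph.mem_neighborSet, Walk.adj_toSubgraph_iff_mem_edges,
      Walk.adj_toSubgraph_iff_mem_edges]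
    exact Set.ext_iff.mp he s(x, y)
  refine Walk.ext_getVert_le_length hl fun k hk => ?_
  -- Induction on pairs of consecutive vertices: the neighbours of a vertex in the cycle are its
  -- predecessor and its successor, so the common predecessor determines the successor.
  have key : ∀ k, k + 1 ≤ p.length →
      p.getVert k = q.getVert k ∧ p.getVert (k + 1) = q.getVert (k + 1) := by
    intro k
    induction k with
    | zero => exact fun _ => ⟨by simp, h1⟩
    | succ k ih =>
      intro hk
      obtain ⟨ha, hb⟩ := ih (by omega)
      refine ⟨hb, ?_⟩
      have hx := hnb (p.getVert (k + 1))
      rw [hp.neighborSet_toSubgraph_internal (by omega) (by omega), hb,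
        hq.neighborSet_toSubgraph_internal (by omega) (by omega)] at hx
      have hmem : p.getVert (k + 1 + 1) ∈
          ({q.getVert (k + 1 - 1), q.getVert (k + 1 + 1)} : Set V) := by
        rw [← hx]; simp
      have hne := hp.getVert_sub_one_ne_getVert_add_one (i := k + 1) (by omega)
      simp only [Nat.add_sub_cancel] at hmem hne
      rcases hmem with h | h
      · exact absurd (ha.trans h.symm) hne
      · exact h
  cases k with
  | zero => simp
  | succ k => exact (key k hk).2

namespace RainbowGraphs

/-! ### Closed walks in a Cayley graph of involutions as words -/

section Words

variable {Γ ι : Type*} [Group Γ] {G : SimpleGraph Γ} {s : ι → Γ}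

/-- `G` is the right Cayley graph of the family `s` of distinct involutions. -/
structure IsInvolutionCayley (G : SimpleGraph Γ) (s : ι → Γ) : Prop where
  adj_iff : ∀ x y, G.Adj x y ↔ ∃ i, y = x * s i
  mul_self : ∀ i, s i * s i = 1
  injective : Function.Injective s

theorem IsInvolutionCayley.adj (h : IsInvolutionCayley G s) (x : Γ) (i : ι) :
    G.Adj x (x * s i) := (h.adj_iff _ _).mpr ⟨i, rfl⟩

/-- The walk from `u` which spells the word `w`. -/
def wordWalk (hG : IsInvolutionCayley G s) : (u : Γ) → (w : List ι) → (v : Γ) →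
    u * (w.map s).prod = v → G.Walk u v
  | u, [], v, h => Walk.nil.copy rfl (show u = v by simpa using h)
  | u, i :: w, v, h => Walk.cons (hG.adj u i) (wordWalk hG (u * s i) w v (by
      rw [← h, List.map_cons, List.prod_cons, mul_assoc]))

theorem length_wordWalk (hG : IsInvolutionCayley G s) (u : Γ) (w : List ι) (v : Γ) (h) :
    (wordWalk hG u w v h).length = w.length := by
  induction w generalizing u with
  | nil => simp [wordWalk]
  | cons i w ih => simp [wordWalk, ih]

theorem wordWalk_injective (hG : IsInvolutionCayley G s) {u v : Γ} {w w' : List ι} {h h'}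
    (he : wordWalk hG u w v h = wordWalk hG u w' v h') : w = w' := by
  induction w generalizing u w' with
  | nil =>
    have := congrArg Walk.length he
    rw [length_wordWalk, length_wordWalk] at this
    exact (List.length_eq_zero_iff.mp this.symm).symm
  | cons i w ih =>
    cases w' with
    | nil =>
      have := congrArg Walk.length he
      rw [length_wordWalk, length_wordWalk] at this
      simp at this
    | cons j w' =>
      simp only [wordWalk] at he
      have hij : i = j := by
        have := congrArg Walk.snd he
        simp only [Walk.snd_cons] at this
        exact hG.injective (mul_left_cancel this)
      subst hij
      simp only [Walk.cons.injEq, heq_eq_eq, true_and] at he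
      rw [ih he]

theorem exists_wordWalk (hG : IsInvolutionCayley G s)
    {u v : Γ} (p : G.Walk u v) : ∃ w h, p = wordWalk hG u w v h := by
  induction p with
  | nil => exact ⟨[], by simp, by simp [wordWalk]⟩
  | @cons u x v hadj p ih =>
    obtain ⟨w, h, rfl⟩ := ih
    obtain ⟨i, rfl⟩ := (hG.adj_iff _ _).mp hadj
    exact ⟨i :: w, by rw [← h, List.map_cons, List.prod_cons, mul_assoc], rfl⟩

/-- A repeated letter would run back along the edge just used, since each generator is an
involution. -/
theorem isChain_of_isTrail (hG : IsInvolutionCayley G s) {u v : Γ} {w : List ι} {h}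
    (ht : (wordWalk hG u w v h).IsTrail) : w.IsChain (· ≠ ·) := by
  induction w generalizing u with
  | nil => exact List.isChain_nil
  | cons i w ih =>
    simp only [wordWalk, Walk.isTrail_cons] at ht
    cases w with
    | nil => exact List.isChain_singleton i
    | cons j w =>
      refine List.isChain_cons_cons.mpr ⟨?_, ih ht.1⟩
      rintro rfl
      apply ht.2
      simp only [wordWalk, Walk.edges_cons, List.mem_cons]
      left
      rw [mul_assoc, hG.mul_self, mul_one, Sym2.eq_swap]

theorem exists_prefix_of_mem_support (hG : IsInvolutionCayley G s) {u v x : Γ} {w : List ι} {h}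
    (hx : x ∈ (wordWalk hG u w v h).support) :
    ∃ w', w' <+: w ∧ x = u * (w'.map s).prod := by
  induction w generalizing u with
  | nil =>
    simp only [wordWalk, Walk.support_copy, Walk.support_nil, List.mem_singleton] at hx
    exact ⟨[], by simp, by simpa using hx⟩
  | cons i w ih =>
    simp only [wordWalk, Walk.support_cons, List.mem_cons] at hx
    rcases hx with rfl | hx
    · exact ⟨[], by simp, by simp⟩
    · obtain ⟨w', hw', rfl⟩ := ih hx
      exact ⟨i :: w', by simpa using hw', by simp [mul_assoc]⟩

/-- No nonempty reduced word of length less than `g` represents the identity. -/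
def NoShortRelation (s : ι → Γ) (g : ℕ) : Prop :=
  ∀ w : List ι, w.IsChain (· ≠ ·) → w ≠ [] → w.length < g → (w.map s).prod ≠ 1

/-- A return to the starting vertex would make a nonempty prefix a short relation; induction treats
the later vertices. -/
theorem isPath_wordWalk (hG : IsInvolutionCayley G s)
    {g : ℕ} (hs : NoShortRelation s g) {u v : Γ} {w : List ι} {h}
    (hw : w.IsChain (· ≠ ·)) (hl : w.length < g) : (wordWalk hG u w v h).IsPath := by
  induction w generalizing u with
  | nil => simp [wordWalk]
  | cons i w ih =>
    simp only [wordWalk]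
    rw [Walk.cons_isPath_iff]
    refine ⟨ih hw.tail (by simp at hl; omega), fun hmem => ?_⟩
    obtain ⟨w', hw', he⟩ := exists_prefix_of_mem_support hG hmem
    have hpre : i :: w' <+: i :: w := by simpa using hw'
    refine hs (i :: w') (hw.prefix hpre) (by simp) (hpre.length_le.trans_lt hl) ?_
    rw [mul_assoc] at he
    simpa using he

theorem isCycle_wordWalk (hG : IsInvolutionCayley G s)
    {g : ℕ} (hs : NoShortRelation s g) (hg : 3 ≤ g) {u : Γ} {w : List ι} {h}
    (hw : w.IsChain (· ≠ ·)) (hl : w.length = g) : (wordWalk hG u w u h).IsCycle := by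
  rw [Walk.isCycle_iff_isPath_tail_and_le_length, length_wordWalk]
  refine ⟨?_, by omega⟩
  cases w with
  | nil => simp at hl; omega
  | cons i w =>
    simp only [wordWalk, Walk.tail_cons]
    refine (Walk.isPath_copy _ _ _).mpr (isPath_wordWalk (w := w) hG hs hw.tail ?_)
    simp at hl; omega

theorem le_length_of_isCycle (hG : IsInvolutionCayley G s)
    {g : ℕ} (hs : NoShortRelation s g) {u : Γ} {p : G.Walk u u}
    (hp : p.IsCycle) : g ≤ p.length := by
  obtain ⟨w, h, rfl⟩ := exists_wordWalk hG p
  by_contra! hlt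
  have h3 := hp.three_le_length
  rw [length_wordWalk] at hlt h3
  exact hs w (isChain_of_isTrail hG hp.isTrail) (by rintro rfl; simp at h3) hlt (by simpa using h)

theorem girth_eq_of_words (hG : IsInvolutionCayley G s)
    {g : ℕ} (hs : NoShortRelation s g) (hg : 3 ≤ g) {w : List ι}
    (hw : w.IsChain (· ≠ ·)) (hl : w.length = g) (h1 : (w.map s).prod = 1) : G.girth = g := by
  have hc := isCycle_wordWalk hG hs hg (u := 1) (h := by simpa using h1) hw hl
  have hle := G.girth_le_length hc
  rw [length_wordWalk, hl] at hle
  refine le_antisymm hle ?_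
  obtain ⟨a, p, hp, he⟩ := G.exists_girth_eq_length.mpr (fun hac => hac _ hc)
  rw [he]
  exact le_length_of_isCycle hG hs hp

/-- A girth cycle through the edge `{v, v * s i}` is spelled by exactly one reduced word that
starts with `i`. -/
theorem girthCycleCount_eq_card (hG : IsInvolutionCayley G s)
    {g : ℕ} (hs : NoShortRelation s g) (hg : 3 ≤ g)
    (hgirth : G.girth = g) (v : Γ) (i : ι) (W : Finset (List ι))
    (hW : ∀ w, w ∈ W ↔ w.IsChain (· ≠ ·) ∧ w.length = g ∧ w.head? = some i ∧ (w.map s).prod = 1) :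
    girthCycleCount G s(v, v * s i) = W.card := by
  classical
  have hprod : ∀ w ∈ W, v * (w.map s).prod = v := fun w hw => by simp [((hW w).mp hw).2.2.2]
  -- The value `∅` never occurs on `W`; it only makes `F` total.
  let F : List ι → Set (Sym2 Γ) := fun w =>
    if h : v * (w.map s).prod = v then (wordWalk hG v w v h).edgeSet else ∅
  have hF : ∀ w (hw : w ∈ W), F w = (wordWalk hG v w v (hprod w hw)).edgeSet :=
    fun w hw => dif_pos _
  have hsnd : ∀ w (h : v * (w.map s).prod = v), w.head? = some i →
      (wordWalk hG v w v h).snd = v * s i := by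
    intro w h hh
    cases w with
    | nil => simp at hh
    | cons j w =>
      obtain rfl : j = i := by simpa using hh
      simp [wordWalk]
  have hcyc : ∀ w (hw : w ∈ W), (wordWalk hG v w v (hprod w hw)).IsCycle := fun w hw =>
    isCycle_wordWalk hG hs hg ((hW w).mp hw).1 ((hW w).mp hw).2.1
  have hinj : Set.InjOn F (W : Set (List ι)) := by
    intro w hw w' hw' he
    rw [hF w hw, hF w' hw'] at he
    refine wordWalk_injective hG ((hcyc w hw).eq_of_edgeSet_eq (hcyc w' hw') ?_ he ?_)
    · rw [length_wordWalk, length_wordWalk, ((hW w).mp hw).2.1, ((hW w').mp hw').2.1]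
    · rw [hsnd _ _ ((hW w).mp hw).2.2.1, hsnd _ _ ((hW w').mp hw').2.2.1]
  have himg : {C ∈ girthCycles G | s(v, v * s i) ∈ C} = F '' (W : Set (List ι)) := by
    ext C
    constructor
    · rintro ⟨⟨x, p, hp, hl, rfl⟩, hmem⟩
      rw [Walk.mem_edgeSet] at hmem
      have hv : v ∈ p.support := p.fst_mem_support_of_mem_edges hmem
      have hq : (p.rotate v hv).IsCycle := hp.rotate hv
      have hqe : (p.rotate v hv).edgeSet = p.edgeSet := by
        ext e
        exact (p.rotate_edges v hv).mem_iff
      have hql : (p.rotate v hv).length = g := by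
        rw [Walk.length_rotate, hl, hgirth]
      generalize p.rotate v hv = q at hq hqe hql
      -- The rotated cycle uses the given edge either as its first or as its last step; in the
      -- second case it is reversed.
      obtain ⟨r, hr, hre, hrl, hrs⟩ : ∃ r : G.Walk v v, r.IsCycle ∧ r.edgeSet = p.edgeSet ∧
          r.length = g ∧ r.snd = v * s i := by
        have hnb : v * s i ∈ q.toSubgraph.neighborSet v := by
          rw [Subgraph.mem_neighborSet, Walk.adj_toSubgraph_iff_mem_edges, ← Walk.mem_edgeSet, hqe]
          exact hmem
        rw [hq.neighborSet_toSubgraph_endpoint] at hnb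
        rcases hnb with h | h
        · exact ⟨q, hq, hqe, hql, h.symm⟩
        · refine ⟨q.reverse, hq.reverse, by rw [Walk.edgeSet_reverse, hqe], by simpa using hql, ?_⟩
          rw [Set.mem_singleton_iff] at h
          rw [Walk.snd_reverse, h]
      obtain ⟨w, h, rfl⟩ := exists_wordWalk hG r
      rw [length_wordWalk] at hrl
      refine ⟨w, ?_, ?_⟩
      · rw [Finset.mem_coe, hW]
        refine ⟨isChain_of_isTrail hG hr.isTrail, hrl, ?_, by simpa using h⟩
        cases w with
        | nil => simp at hrl; omega
        | cons j w =>
          simp only [wordWalk, Walk.snd_cons] at hrs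
          rw [hG.injective (mul_left_cancel hrs)]
          rfl
      · rw [← hre]
        exact dif_pos h
    · rintro ⟨w, hw, rfl⟩
      rw [hF w hw]
      refine ⟨⟨v, _, hcyc w hw, ?_, rfl⟩, ?_⟩
      · rw [length_wordWalk, ((hW w).mp hw).2.1, hgirth]
      · have := (wordWalk hG v w v (hprod w hw)).toSubgraph_adj_snd (hcyc w hw).not_nil
        rw [Walk.adj_toSubgraph_iff_mem_edges, hsnd _ _ ((hW w).mp hw).2.2.1] at this
        exact this
  rw [girthCycleCount, himg, hinj.ncard_image, Set.ncard_coe_finset]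

end Words

/-! ### Generators and integer coordinates in S₃ × D_∞ -/

/-- The three generators of the Cayley graph `X n`. -/
def gen (n : ℕ) : Fin 3 → Equiv.Perm (Fin 3) × DihedralGroup n :=
  ![(Equiv.swap 0 1, 1), (Equiv.swap 0 2, DihedralGroup.sr 0),
    (Equiv.swap 1 2, DihedralGroup.sr 1)]

theorem gen_mul_self (n : ℕ) (i : Fin 3) : gen n i * gen n i = 1 := by
  fin_cases i <;> simp [gen, Prod.ext_iff]

theorem fst_gen (n : ℕ) (i : Fin 3) :
    (gen n i).1 = ![Equiv.swap 0 1, Equiv.swap 0 2, Equiv.swap 1 2] i := by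
  fin_cases i <;> rfl

theorem fst_gen_injective (n : ℕ) : Function.Injective fun i => (gen n i).1 := by
  simp only [fst_gen]
  decide

theorem gen_ne_one (n : ℕ) (i : Fin 3) : gen n i ≠ 1 := by
  intro h
  have h := congrArg Prod.fst h
  fin_cases i <;> exact absurd h (by simp [gen])

theorem isInvolutionCayley_X (n : ℕ) : IsInvolutionCayley (X n) (gen n) where
  adj_iff x y := by
    have hset : ∀ g, g ∈ ({(Equiv.swap 0 1, 1), (Equiv.swap 0 2, DihedralGroup.sr 0),
        (Equiv.swap 1 2, DihedralGroup.sr 0 * DihedralGroup.r 1)} :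
          Set (Equiv.Perm (Fin 3) × DihedralGroup n)) ↔ ∃ i, g = gen n i := by
      intro g
      rw [Fin.exists_fin_succ, Fin.exists_fin_two]
      simp [gen]
    rw [X, mulCayley_adj']
    constructor
    · rintro ⟨-, g, hg, h⟩
      obtain ⟨i, rfl⟩ := (hset g).mp hg
      rcases h with h | h
      · exact ⟨i, h.symm⟩
      · exact ⟨i, by rw [h, mul_assoc, gen_mul_self, mul_one]⟩
    · rintro ⟨i, rfl⟩
      exact ⟨fun h => gen_ne_one n i (by simpa using h), gen n i, (hset _).mpr ⟨i, rfl⟩, Or.inl rfl⟩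
  mul_self := gen_mul_self n
  injective i j h := fst_gen_injective n (congrArg Prod.fst h)

/-- Coordinates for `S₃ × D_∞`: the values of a permutation, the exponent of the rotation, and
whether the dihedral component is a reflection. -/
abbrev Coord := (Fin 3 × Fin 3 × Fin 3) × ℤ × Bool

/-- Right multiplication by a generator in coordinates. -/
def Coord.step : Coord → Fin 3 → Coord
  | ((a, b, c), k, e), 0 => ((b, a, c), k, e)
  -- Both `r k * sr j` and `sr k * sr j` have exponent `j - k`, so the formula does not depend on
  -- `e`.
  | ((a, b, c), k, e), 1 => ((c, b, a), -k, !e)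
  | ((a, b, c), k, e), 2 => ((a, c, b), 1 - k, !e)

/-- The coordinates of the element of `S₃ × D_∞` spelled by a word. -/
def Coord.ofWord (w : List (Fin 3)) : Coord := w.foldl Coord.step ((0, 1, 2), 0, false)

/-- The coordinates `c` describe `x`. -/
def Coord.Represents {n : ℕ} (c : Coord) (x : Equiv.Perm (Fin 3) × DihedralGroup n) : Prop :=
  c.1 = (x.1 0, x.1 1, x.1 2) ∧
    x.2 = if c.2.2 then DihedralGroup.sr (c.2.1 : ZMod n) else DihedralGroup.r (c.2.1 : ZMod n)

theorem Coord.Represents.step {n : ℕ} {c : Coord} {x : Equiv.Perm (Fin 3) × DihedralGroup n}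
    (h : c.Represents x) (i : Fin 3) : (c.step i).Represents (x * gen n i) := by
  obtain ⟨⟨a, b, d⟩, k, e⟩ := c
  obtain ⟨σ, y⟩ := x
  obtain ⟨h1, h2⟩ := h
  simp only [Prod.mk.injEq] at h1
  obtain ⟨rfl, rfl, rfl⟩ := h1
  simp only at h2
  subst h2
  have e1 : Equiv.swap (0 : Fin 3) 1 2 = 2 := by decide
  have e2 : Equiv.swap (0 : Fin 3) 2 1 = 1 := by decide
  have e3 : Equiv.swap (1 : Fin 3) 2 0 = 0 := by decide
  fin_cases i <;> cases e <;>
    simp [Coord.step, Coord.Represents, gen, e1, e2, e3]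

theorem Coord.represents_ofWord (n : ℕ) (w : List (Fin 3)) :
    (Coord.ofWord w).Represents (w.map (gen n)).prod := by
  have key : ∀ (w : List (Fin 3)) (c : Coord) (x : Equiv.Perm (Fin 3) × DihedralGroup n),
      c.Represents x → (w.foldl Coord.step c).Represents (x * (w.map (gen n)).prod) := by
    intro w
    induction w with
    | nil => intro c x h; simpa using h
    | cons i w ih =>
      intro c x h
      rw [List.foldl_cons, List.map_cons, List.prod_cons, ← mul_assoc]
      exact ih _ _ (h.step i)
  have h1 : Coord.Represents (n := n) ((0, 1, 2), 0, false) 1 :=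
    ⟨rfl, by simp⟩
  rw [← one_mul (w.map (gen n)).prod]
  exact key w _ _ h1

/-- The coordinates of a word are free of `n`, which is what allows a single enumeration to serve
every `n`. -/
theorem prod_gen_eq_one_iff (n : ℕ) (w : List (Fin 3)) :
    (w.map (gen n)).prod = 1 ↔ (Coord.ofWord w).1 = (0, 1, 2) ∧ (Coord.ofWord w).2.2 = false ∧
      (n : ℤ) ∣ (Coord.ofWord w).2.1 := by
  obtain ⟨h1, h2⟩ := Coord.represents_ofWord n w
  generalize (w.map (gen n)).prod = x at h1 h2
  rw [← ZMod.intCast_zmod_eq_zero_iff_dvd, h1, Prod.ext_iff, Equiv.ext_iff, h2,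
    Prod.snd_one, DihedralGroup.one_def, Fin.forall_fin_succ, Fin.forall_fin_two]
  cases (Coord.ofWord w).2.2 <;> simp [and_assoc, - DihedralGroup.r_zero]

/-- The reduced words of length `m + 1` which start with `i`. -/
def redWords : ℕ → Fin 3 → List (List (Fin 3))
  | 0, i => [[i]]
  | m + 1, i => ((List.finRange 3).filter (i ≠ ·)).flatMap fun j => (redWords m j).map (i :: ·)

theorem mem_redWords (m : ℕ) (i : Fin 3) (w : List (Fin 3)) :
    w ∈ redWords m i ↔ w.IsChain (· ≠ ·) ∧ w.length = m + 1 ∧ w.head? = some i := by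
  induction m generalizing i w with
  | zero =>
    simp only [redWords, List.mem_singleton]
    constructor
    · rintro rfl; simp
    · rintro ⟨-, h, h'⟩
      obtain ⟨a, rfl⟩ := List.length_eq_one_iff.mp h
      simpa using h'
  | succ m ih =>
    simp only [redWords, List.mem_flatMap, List.mem_filter, List.mem_finRange, List.mem_map, ih]
    constructor
    · rintro ⟨j, hj, w, ⟨h1, h2, h3⟩, rfl⟩
      obtain ⟨k, w, rfl⟩ := List.exists_cons_of_length_eq_add_one h2
      obtain rfl : k = j := by simpa using h3
      exact ⟨List.isChain_cons_cons.mpr ⟨by simpa using hj, h1⟩, by simpa using h2, rfl⟩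
    · rintro ⟨h1, h2, h3⟩
      obtain ⟨k, w, rfl⟩ := List.exists_cons_of_length_eq_add_one h2
      obtain rfl : k = i := by simpa using h3
      obtain ⟨j, w, rfl⟩ := List.exists_cons_of_length_eq_add_one (by simpa using h2)
      rw [List.isChain_cons_cons] at h1
      exact ⟨j, by simpa using h1.1, j :: w, ⟨h1.2, by simpa using h2, rfl⟩, rfl⟩

/-- The word represents an element of the rotation subgroup of `D_∞`. -/
abbrev Coord.IsRotation (c : Coord) : Prop := c.1 = (0, 1, 2) ∧ c.2.2 = false

/-! ### Enumeration of reduced words, girth and signature -/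

/-- The bound 4 handles all n ≥ 4 at once: an exponent of absolute value below 4 is divisible by n
only if it is 0. The index `m` stands for words of length `m + 1`. -/
theorem rotation_of_redWords_lt : ∀ m < 7, ∀ i, ∀ w ∈ redWords m i,
    (Coord.ofWord w).IsRotation → (Coord.ofWord w).2.1 ≠ 0 ∧ (Coord.ofWord w).2.1.natAbs < 4 := by
  decide +kernel

theorem rotation_of_redWords_seven : ∀ i, ∀ w ∈ redWords 7 i,
    (Coord.ofWord w).IsRotation → (Coord.ofWord w).2.1.natAbs < 4 := by
  decide +kernel

theorem rotation_of_redWords_lt_five : ∀ m < 5, ∀ i, ∀ w ∈ redWords m i,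
    (Coord.ofWord w).IsRotation → ¬ (3 : ℤ) ∣ (Coord.ofWord w).2.1 := by
  decide +kernel

theorem card_filter_redWords_seven (i : Fin 3) :
    ((redWords 7 i).toFinset.filter fun w =>
      (Coord.ofWord w).IsRotation ∧ (Coord.ofWord w).2.1 = 0).card = ![6, 5, 5] i := by
  revert i
  decide +kernel

/-- The words counted are 121212 and 212121, with exponents 3 and -3: in X_3 the last two generators
close up to hexagons. -/
theorem card_filter_redWords_five (i : Fin 3) :
    ((redWords 5 i).toFinset.filter fun w =>
      (Coord.ofWord w).IsRotation ∧ (3 : ℤ) ∣ (Coord.ofWord w).2.1).card = ![0, 1, 1] i := by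
  revert i
  decide +kernel

open Classical in
theorem IsInvolutionCayley.isRegularOfDegree {Γ ι : Type*} [Group Γ] [Fintype Γ] [Fintype ι]
    {G : SimpleGraph Γ} {s : ι → Γ} (hG : IsInvolutionCayley G s) :
    G.IsRegularOfDegree (Fintype.card ι) := by
  intro v
  have h : G.neighborFinset v = Finset.univ.image fun i => v * s i := by
    ext x
    simp [hG.adj_iff, eq_comm]
  rw [← card_neighborFinset_eq_degree, h, Finset.card_image_of_injective _
    fun i j h => hG.injective (mul_left_cancel h), Finset.card_univ]

theorem IsInvolutionCayley.hasSignature {Γ ι : Type*} [Group Γ] [Fintype Γ] [Fintype ι]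
    {G : SimpleGraph Γ} {s : ι → Γ} (hG : IsInvolutionCayley G s) {c : ι → ℕ}
    (hc : ∀ v i, girthCycleCount G s(v, v * s i) = c i) :
    HasSignature G ((Finset.univ.val.map c).sort (· ≤ ·)) := by
  classical
  refine ⟨⟨_, fun v => by convert hG.isRegularOfDegree v⟩, fun v => ?_⟩
  have hinj : Function.Injective fun i => s(v, v * s i) := fun i j h =>
    hG.injective (mul_left_cancel (Sym2.congr_right.mp h))
  have h : ∀ [Fintype (G.neighborSet v)] [DecidableEq Γ],
      G.incidenceFinset v = Finset.univ.map ⟨_, hinj⟩ := by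
    intro _ _
    ext e
    simp only [mem_incidenceFinset, Finset.mem_map, Finset.mem_univ, true_and,
      Function.Embedding.coeFn_mk]
    constructor
    · rintro ⟨he, hv⟩
      obtain ⟨x, rfl⟩ := Sym2.mem_iff_exists.mp hv
      obtain ⟨i, hi⟩ := (hG.adj_iff v x).mp he
      exact ⟨i, by rw [hi]⟩
    · rintro ⟨i, rfl⟩
      exact ⟨hG.adj v i, by simp⟩
  rw [vertexSignature, h, Finset.map_val, Multiset.map_map]
  congr 2
  exact funext (hc v)

theorem noShortRelation_gen {n g : ℕ} (h : ∀ m < g, ∀ i, ∀ w ∈ redWords m i,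
    (Coord.ofWord w).IsRotation → ¬ (n : ℤ) ∣ (Coord.ofWord w).2.1) :
    NoShortRelation (gen n) (g + 1) := by
  intro w hw hne hl h1
  obtain ⟨i, w, rfl⟩ := List.exists_cons_of_ne_nil hne
  rw [prod_gen_eq_one_iff] at h1
  exact h w.length (by simpa using hl) i (i :: w)
    ((mem_redWords _ _ _).mpr ⟨hw, rfl, rfl⟩) ⟨h1.1, h1.2.1⟩ h1.2.2

/-- The girth of `X n`, and the number of girth cycles through an edge, from an enumeration of the
reduced words. -/
theorem girth_X_and_girthCycleCount {n g : ℕ} (hg : 2 ≤ g)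
    (hs : ∀ m < g, ∀ i, ∀ w ∈ redWords m i,
      (Coord.ofWord w).IsRotation → ¬ (n : ℤ) ∣ (Coord.ofWord w).2.1)
    {c : Fin 3 → ℕ} (hc : ∀ i, ((redWords g i).toFinset.filter fun w =>
      (Coord.ofWord w).IsRotation ∧ (n : ℤ) ∣ (Coord.ofWord w).2.1).card = c i)
    {i : Fin 3} (hi : c i ≠ 0) :
    (X n).girth = g + 1 ∧ ∀ v i, girthCycleCount (X n) s(v, v * gen n i) = c i := by
  have hG := isInvolutionCayley_X n
  have hshort := noShortRelation_gen hs
  have hgirth : (X n).girth = g + 1 := by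
    -- A nonzero count supplies a relation of length `g + 1`, hence a cycle attaining the lower
    -- bound.
    rw [← hc, Finset.card_ne_zero] at hi
    obtain ⟨w, hw⟩ := hi
    rw [Finset.mem_filter, List.mem_toFinset, mem_redWords] at hw
    exact girth_eq_of_words hG hshort (by omega) hw.1.1 hw.1.2.1
      ((prod_gen_eq_one_iff n w).mpr ⟨hw.2.1.1, hw.2.1.2, hw.2.2⟩)
  refine ⟨hgirth, fun v i => ?_⟩
  rw [← hc i]
  refine girthCycleCount_eq_card hG hshort (by omega) hgirth v i _ fun w => ?_
  rw [Finset.mem_filter, List.mem_toFinset, mem_redWords, prod_gen_eq_one_iff]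
  tauto

theorem girth_X_three : (X 3).girth = 6 ∧
    ∀ v i, girthCycleCount (X 3) s(v, v * gen 3 i) = ![0, 1, 1] i :=
  girth_X_and_girthCycleCount (g := 5) (i := 1) (by norm_num) rotation_of_redWords_lt_five
    card_filter_redWords_five (by simp)

theorem girth_X_of_four_le {n : ℕ} (hn : 4 ≤ n) : (X n).girth = 8 ∧
    ∀ v i, girthCycleCount (X n) s(v, v * gen n i) = ![6, 5, 5] i := by
  have hdvd : ∀ k : ℤ, k.natAbs < 4 → ((n : ℤ) ∣ k ↔ k = 0) := by
    intro k hk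
    constructor
    · intro h
      exact Int.eq_zero_of_abs_lt_dvd h (by rw [Int.abs_eq_natAbs]; omega)
    · rintro rfl
      exact dvd_zero _
  refine girth_X_and_girthCycleCount (g := 7) (i := 1) (by norm_num) ?_ ?_ (by simp)
  · intro m hm i w hw hr
    obtain ⟨h0, h4⟩ := rotation_of_redWords_lt m hm i w hw hr
    rwa [hdvd _ h4]
  · intro i
    rw [← card_filter_redWords_seven i]
    congr 1
    refine Finset.filter_congr fun w hw => and_congr_right fun hr => ?_
    exact hdvd _ (rotation_of_redWords_seven i w (List.mem_toFinset.mp hw) hr)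

theorem sort_map_univ {c : Fin 3 → ℕ} {l : List ℕ} (h : (Finset.univ.val.map c) = l)
    (hl : l.Pairwise (· ≤ ·)) : (Finset.univ.val.map c).sort (· ≤ ·) = l := by
  rw [h, Multiset.coe_sort]
  exact List.mergeSort_of_pairwise (by simpa using hl)

theorem hasSignature_X_three : HasSignature (X 3) [0, 1, 1] := by
  convert (isInvolutionCayley_X 3).hasSignature girth_X_three.2 using 1
  exact (sort_map_univ (by decide) (by decide)).symm

theorem hasSignature_X_of_four_le {n : ℕ} [NeZero n] (hn : 4 ≤ n) :
    HasSignature (X n) [5, 5, 6] := by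
  convert (isInvolutionCayley_X n).hasSignature (girth_X_of_four_le hn).2 using 1
  exact (sort_map_univ (by decide) (by decide)).symm

/-! ### Transitivity, connectedness and rainbow domination -/

theorem isVertexTransitive_mulCayley {Γ : Type*} [Group Γ] (S : Set Γ) :
    IsVertexTransitive (mulCayley S) := fun u v =>
  ⟨⟨Equiv.mulLeft (v * u⁻¹), mulCayley_adj_mul_iff_right⟩, by simp⟩

theorem IsInvolutionCayley.connected {Γ ι : Type*} [Group Γ] {G : SimpleGraph Γ} {s : ι → Γ}
    (hG : IsInvolutionCayley G s) (hs : Subgroup.closure (Set.range s) = ⊤) : G.Connected := by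
  -- The elements whose right translation preserves every connected component form a subgroup.
  let H : Subgroup Γ :=
    { carrier := {x | ∀ y, G.Reachable y (y * x)}
      mul_mem' := fun {a b} ha hb y => by
        rw [← mul_assoc]
        exact (ha y).trans (hb (y * a))
      one_mem' := fun y => by rw [mul_one]
      inv_mem' := fun {a} ha y => by simpa using (ha (y * a⁻¹)).symm }
  have hH : H = ⊤ := by
    rw [← top_le_iff, ← hs, Subgroup.closure_le]
    rintro _ ⟨i, rfl⟩ y
    exact (hG.adj y i).reachable
  refine (connected_iff _).mpr ⟨fun x y => ?_, ⟨1⟩⟩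
  have : x⁻¹ * y ∈ H := by rw [hH]; trivial
  simpa using this x

theorem closure_range_gen (n : ℕ) : Subgroup.closure (Set.range (gen n)) = ⊤ := by
  set H := Subgroup.closure (Set.range (gen n)) with hH
  have hgen : ∀ i, gen n i ∈ H := fun i => Subgroup.subset_closure ⟨i, rfl⟩
  have hperm : ∀ σ : Equiv.Perm (Fin 3), ((σ, 1) : Equiv.Perm (Fin 3) × DihedralGroup n) ∈ H := by
    intro σ
    have h0 : ((Equiv.swap 0 1, 1) : Equiv.Perm (Fin 3) × DihedralGroup n) ∈ H := hgen 0
    -- The square of `gen 0 * gen 1` has trivial dihedral part, because z² = 1, and a 3-cycle as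
    -- permutation; with `gen 0` it generates S₃ × 1.
    have h1 : ((Equiv.swap 0 1 * Equiv.swap 0 2 * Equiv.swap 0 1 * Equiv.swap 0 2, 1) :
        Equiv.Perm (Fin 3) × DihedralGroup n) ∈ H := by
      have := H.mul_mem (H.mul_mem (H.mul_mem (hgen 0) (hgen 1)) (hgen 0)) (hgen 1)
      simpa [gen] using this
    obtain ⟨a, b, rfl⟩ : ∃ a b : Fin 3, σ = Equiv.swap 0 1 ^ (a : ℕ) *
        (Equiv.swap 0 1 * Equiv.swap 0 2 * Equiv.swap 0 1 * Equiv.swap 0 2) ^ (b : ℕ) := by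
      revert σ
      decide
    have := H.mul_mem (H.pow_mem h0 a) (H.pow_mem h1 b)
    simpa using this
  have hdihedral : ∀ i σ, (gen n i).1 = σ →
      ((1, (gen n i).2) : Equiv.Perm (Fin 3) × DihedralGroup n) ∈ H := by
    rintro i σ rfl
    have := H.mul_mem (hperm (gen n i).1⁻¹) (hgen i)
    rw [Prod.mul_def] at this
    simpa using this
  have hz : ((1, DihedralGroup.sr 0) : Equiv.Perm (Fin 3) × DihedralGroup n) ∈ H :=
    hdihedral 1 _ rfl
  have hr : ∀ i, ((1, DihedralGroup.r i) : Equiv.Perm (Fin 3) × DihedralGroup n) ∈ H := by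
    intro i
    have h2 := H.mul_mem hz (hdihedral 2 _ rfl)
    have h3 := H.zpow_mem h2 i.cast
    simpa [gen] using h3
  rw [eq_top_iff]
  rintro ⟨σ, y⟩ -
  have hy : ((1, y) : Equiv.Perm (Fin 3) × DihedralGroup n) ∈ H := by
    cases y with
    | r i => exact hr i
    | sr i => simpa using H.mul_mem hz (hr i)
  simpa using H.mul_mem (hperm σ) hy

theorem connected_X (n : ℕ) : (X n).Connected :=
  (isInvolutionCayley_X n).connected (closure_range_gen n)

open Classical in
/-- In a `d`-regular graph a `d`-rainbow dominating function has weight at least half the number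
of vertices. -/
theorem IsRainbowDominating.card_le_two_mul_weight {V : Type*} [Fintype V] {G : SimpleGraph V}
    {d : ℕ} (hd : 0 < d) (hG : G.IsRegularOfDegree d) {f : V → Finset (Fin d)}
    (hf : IsRainbowDominating d G f) : Fintype.card V ≤ 2 * rainbowWeight f := by
  -- Every vertex is a neighbour of `d` vertices, so summing `hlocal` below gives d|V| ≤ 2d times
  -- the weight.
  have hswap : ∑ v, ∑ u ∈ G.neighborFinset v, (f u).card = d * rainbowWeight f := by
    rw [Finset.sum_comm' (t' := Finset.univ) (s' := fun u => G.neighborFinset u)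
      (by simp [G.adj_comm]), rainbowWeight, Finset.mul_sum]
    refine Finset.sum_congr rfl fun u _ => ?_
    rw [Finset.sum_const, card_neighborFinset_eq_degree, hG u, smul_eq_mul]
  have hlocal : ∀ v, d ≤ d * (f v).card + ∑ u ∈ G.neighborFinset v, (f u).card := by
    intro v
    rcases (f v).eq_empty_or_nonempty with h | h
    · have hsub : (Finset.univ : Finset (Fin d)) ⊆ (G.neighborFinset v).biUnion f := by
        intro i _
        obtain ⟨u, hu, hi⟩ := hf v h i
        exact Finset.mem_biUnion.mpr ⟨u, by simpa using hu, hi⟩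
      have := (Finset.card_le_card hsub).trans Finset.card_biUnion_le
      rw [Finset.card_univ, Fintype.card_fin] at this
      omega
    · exact Nat.le_add_right_of_le (Nat.le_mul_of_pos_right d h.card_pos)
  have hsum := Finset.sum_le_sum fun v (_ : v ∈ Finset.univ) => hlocal v
  rw [Finset.sum_add_distrib, hswap, ← Finset.mul_sum, Finset.sum_const, Finset.card_univ,
    smul_eq_mul] at hsum
  change _ ≤ d * rainbowWeight f + _ at hsum
  refine le_of_mul_le_mul_left (a := d) ?_ hd
  linarith

theorem card_perm_prod_dihedralGroup (n : ℕ) [NeZero n] :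
    Fintype.card (Equiv.Perm (Fin 3) × DihedralGroup n) = 12 * n := by
  rw [Fintype.card_prod, DihedralGroup.card, Fintype.card_perm, Fintype.card_fin]
  simp only [Nat.factorial]
  ring

/-- The three neighbours of a vertex with odd permutation carry the three even permutations, and
these take distinct values at 0. So colouring each even permutation by its value at 0 dominates,
with weight 3 · 2n. -/
theorem isRDR_X (n : ℕ) [NeZero n] : IsRDR 3 (X n) := by
  have hG := isInvolutionCayley_X n
  have hreg := hG.isRegularOfDegree
  rw [Fintype.card_fin] at hreg
  refine ⟨fun v => by convert hreg v, ?_⟩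
  let f : Equiv.Perm (Fin 3) × DihedralGroup n → Finset (Fin 3) := fun x =>
    if Equiv.Perm.sign x.1 = 1 then {x.1 0} else ∅
  have hf : IsRainbowDominating 3 (X n) f := by
    rintro ⟨σ, y⟩ hv c
    have hσ : Equiv.Perm.sign σ ≠ 1 := by
      intro h
      simp [f, h] at hv
    have hcol : ∀ σ : Equiv.Perm (Fin 3), Equiv.Perm.sign σ ≠ 1 → ∀ c, ∃ i : Fin 3,
        Equiv.Perm.sign (σ * ![Equiv.swap 0 1, Equiv.swap 0 2, Equiv.swap 1 2] i) = 1 ∧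
        c = (σ * ![Equiv.swap 0 1, Equiv.swap 0 2, Equiv.swap 1 2] i : Equiv.Perm (Fin 3)) 0 := by
      decide
    obtain ⟨i, h1, h2⟩ := hcol σ hσ c
    refine ⟨(σ, y) * gen n i, hG.adj _ i, ?_⟩
    simp only [f, Prod.fst_mul, fst_gen, if_pos h1, h2, Finset.mem_singleton]
  have hw : rainbowWeight f = 6 * n := by
    have h3 : ∑ σ : Equiv.Perm (Fin 3),
        (if Equiv.Perm.sign σ = 1 then {σ 0} else ∅ : Finset (Fin 3)).card = 3 := by decide
    rw [rainbowWeight, Fintype.sum_prod_type]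
    simp only [f, Finset.sum_const, Finset.card_univ, DihedralGroup.card, smul_eq_mul]
    rw [← Finset.mul_sum, h3]
    ring
  rw [card_perm_prod_dihedralGroup]
  have hle : rainbowDominationNumber 3 (X n) ≤ 6 * n := Nat.sInf_le ⟨f, hf, hw⟩
  have hge : 12 * n ≤ 2 * rainbowDominationNumber 3 (X n) := by
    obtain ⟨g, hg, hgw⟩ := Nat.sInf_mem (s := {w | ∃ f : _ → Finset (Fin 3),
      IsRainbowDominating 3 (X n) f ∧ rainbowWeight f = w}) ⟨_, f, hf, rfl⟩
    have := hg.card_le_two_mul_weight (by norm_num) (fun v => by convert hreg v)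
    rwa [hgw, card_perm_prod_dihedralGroup] at this
  omega

/-! ### Generalized Petersen presentation when 3 ∤ n -/

section GPAdj

variable {N k : ℕ} {i j : ZMod N}

theorem GP_adj_inl_inl : (GP N k).Adj (.inl i) (.inl j) ↔ i ≠ j ∧ (j = i + 1 ∨ i = j + 1) := by
  simp [GP]

theorem GP_adj_inl_inr : (GP N k).Adj (.inl i) (.inr j) ↔ j = i := by
  simp [GP]

theorem GP_adj_inr_inl : (GP N k).Adj (.inr i) (.inl j) ↔ i = j := by
  simp [GP]

theorem GP_adj_inr_inr :
    (GP N k).Adj (.inr i) (.inr j) ↔ i ≠ j ∧ (j = i + (k : ZMod N) ∨ i = j + (k : ZMod N)) := by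
  simp [GP]

end GPAdj

section Alternating

variable {Γ : Type*} [Group Γ]

/-- The alternating products `… , 1, b, b * c, b * c * b, …`. -/
def altProd (b c : Γ) (i : ℤ) : Γ :=
  if Even i then (b * c) ^ (i / 2) else (b * c) ^ (i / 2) * b

theorem altProd_two_mul (b c : Γ) (m : ℤ) : altProd b c (2 * m) = (b * c) ^ m := by
  simp [altProd]

theorem altProd_two_mul_add_one (b c : Γ) (m : ℤ) :
    altProd b c (2 * m + 1) = (b * c) ^ m * b := by
  have h : ¬ Even (2 * m + 1) := by simp
  rw [altProd, if_neg h]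
  congr 2
  omega

theorem altProd_add_one (b c : Γ) (i : ℤ) :
    altProd b c (i + 1) = altProd b c i * if Even i then b else c := by
  rcases Int.even_or_odd' i with ⟨m, rfl | rfl⟩
  · rw [altProd_two_mul_add_one, altProd_two_mul, if_pos (by simp)]
  · rw [altProd_two_mul_add_one, if_neg (by simp), show 2 * m + 1 + 1 = 2 * (m + 1) by ring,
      altProd_two_mul, zpow_add_one, mul_assoc]

theorem altProd_sub_one {b c : Γ} (hb : b * b = 1) (hc : c * c = 1) (i : ℤ) :
    altProd b c (i - 1) = altProd b c i * if Even i then c else b := by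
  have h := altProd_add_one b c (i - 1)
  rw [sub_add_cancel] at h
  rw [h, mul_assoc]
  by_cases hi : Even i
  · have : ¬ Even (i - 1) := by simpa [Int.even_sub] using hi
    simp [hi, this, hc]
  · have : Even (i - 1) := by simpa [Int.even_sub] using hi
    simp [hi, this, hb]

theorem altProd_add_two_mul {b c : Γ} {m : ℤ} (hm : (b * c) ^ m = 1) (i : ℤ) :
    altProd b c (i + 2 * m) = altProd b c i := by
  rcases Int.even_or_odd' i with ⟨t, rfl | rfl⟩
  · rw [← mul_add, altProd_two_mul, altProd_two_mul, zpow_add, hm, mul_one]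
  · rw [show 2 * t + 1 + 2 * m = 2 * (t + m) + 1 by ring, altProd_two_mul_add_one,
      altProd_two_mul_add_one, zpow_add, hm, mul_one]

end Alternating

/-- The vertices of the cycle of `X n` through `1` whose edges belong to the last two
generators. -/
def rim (n : ℕ) (i : ℤ) : Equiv.Perm (Fin 3) × DihedralGroup n :=
  (altProd (Equiv.swap 0 2) (Equiv.swap 1 2) i,
    altProd (DihedralGroup.sr 0) (DihedralGroup.sr 1) i)

theorem swap_mul_swap_pow_three :
    (Equiv.swap 0 2 * Equiv.swap 1 2 : Equiv.Perm (Fin 3)) ^ 3 = 1 := by decide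

theorem orderOf_swap_mul_swap :
    orderOf (Equiv.swap 0 2 * Equiv.swap 1 2 : Equiv.Perm (Fin 3)) = 3 :=
  orderOf_eq_prime swap_mul_swap_pow_three (by decide)

theorem sr_zero_mul_sr_one_zpow (n : ℕ) (m : ℤ) :
    (DihedralGroup.sr 0 * DihedralGroup.sr 1 : DihedralGroup n) ^ m =
      DihedralGroup.r (m : ZMod n) := by
  simp

theorem rim_add_one (n : ℕ) (i : ℤ) :
    rim n (i + 1) = rim n i * gen n (if Even i then 1 else 2) := by
  rw [rim, altProd_add_one, altProd_add_one]
  split_ifs <;> rfl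

theorem rim_sub_one (n : ℕ) (i : ℤ) :
    rim n (i - 1) = rim n i * gen n (if Even i then 2 else 1) := by
  rw [rim, altProd_sub_one (by decide) (by decide), altProd_sub_one (by simp) (by simp)]
  split_ifs <;> rfl

/-- Odd positions have a reflection as dihedral part, even ones a rotation, so parity is determined.
Within one parity the position counts powers of an element whose components have orders 3 and n, so
coprimality gives order 3n. -/
theorem rim_eq_iff {n : ℕ} (hn : n.Coprime 3) (i j : ℤ) :
    rim n i = rim n j ↔ ((6 * n : ℕ) : ℤ) ∣ i - j := by
  have hD : ∀ m m' : ℤ, (m : ZMod n) = m' ↔ (n : ℤ) ∣ m - m' := fun m m' => by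
    rw [eq_comm, ZMod.intCast_eq_intCast_iff_dvd_sub]
  have hP : ∀ m m' : ℤ, (Equiv.swap 0 2 * Equiv.swap 1 2 : Equiv.Perm (Fin 3)) ^ m =
      (Equiv.swap 0 2 * Equiv.swap 1 2) ^ m' ↔ (3 : ℤ) ∣ m - m' := fun m m' => by
    rw [zpow_eq_zpow_iff_modEq, orderOf_swap_mul_swap, Int.modEq_comm, Int.modEq_iff_dvd]
    rfl
  have hmul : ∀ t : ℤ, ((6 * n : ℕ) : ℤ) ∣ 2 * t ↔ (3 : ℤ) ∣ t ∧ (n : ℤ) ∣ t := by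
    intro t
    rw [show ((6 * n : ℕ) : ℤ) = 2 * (n * 3) by push_cast; ring,
      mul_dvd_mul_iff_left (by norm_num)]
    constructor
    · intro h
      exact ⟨(Dvd.intro_left _ rfl).trans h, (Dvd.intro _ rfl).trans h⟩
    · rintro ⟨h3, hn'⟩
      exact IsCoprime.mul_dvd (by exact_mod_cast hn.isCoprime) hn' h3
  rcases Int.even_or_odd' i with ⟨m, rfl | rfl⟩ <;> rcases Int.even_or_odd' j with ⟨m', rfl | rfl⟩
  · rw [rim, rim, altProd_two_mul, altProd_two_mul, altProd_two_mul, altProd_two_mul, ← mul_sub,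
      hmul, ← hP, ← hD, Prod.mk.injEq, sr_zero_mul_sr_one_zpow, sr_zero_mul_sr_one_zpow,
      DihedralGroup.r.injEq]
  · refine iff_of_false (fun h => ?_) (fun h => ?_)
    · have := congrArg Prod.snd h
      simp [rim, altProd_two_mul, altProd_two_mul_add_one] at this
    · obtain ⟨t, ht⟩ := h
      push_cast at ht
      have : 2 * (m - m' - 3 * (n * t)) = 1 := by linear_combination ht
      omega
  · refine iff_of_false (fun h => ?_) (fun h => ?_)
    · have := congrArg Prod.snd h
      simp [rim, altProd_two_mul, altProd_two_mul_add_one] at this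
    · obtain ⟨t, ht⟩ := h
      push_cast at ht
      have : 2 * (m - m' - 3 * (n * t)) = -1 := by linear_combination ht
      omega
  · rw [rim, rim, altProd_two_mul_add_one, altProd_two_mul_add_one, altProd_two_mul_add_one,
      altProd_two_mul_add_one, show 2 * m + 1 - (2 * m' + 1) = 2 * (m - m') by ring,
      hmul, ← hP, ← hD, Prod.mk.injEq, sr_zero_mul_sr_one_zpow, sr_zero_mul_sr_one_zpow,
      mul_left_inj, mul_left_inj, DihedralGroup.r.injEq]

/-- The parametrisation of the vertices of `X n` by the outer rim and its spokes. -/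
def rimSpoke (n : ℕ) : ZMod (6 * n) ⊕ ZMod (6 * n) → Equiv.Perm (Fin 3) × DihedralGroup n
  | .inl i => rim n i.cast
  | .inr i => rim n i.cast * gen n 0

theorem rim_cast {n : ℕ} (hn : n.Coprime 3) (z : ℤ) :
    rim n (z : ZMod (6 * n)).cast = rim n z := by
  rw [rim_eq_iff hn, ← ZMod.intCast_eq_intCast_iff_dvd_sub]
  simp

/-- The product of the sign of the permutation with the type of the dihedral component. -/
def twistedSign {n : ℕ} : Equiv.Perm (Fin 3) × DihedralGroup n → ℤˣ
  | (σ, .r _) => Equiv.Perm.sign σ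
  | (σ, .sr _) => -Equiv.Perm.sign σ

theorem twistedSign_rim (n : ℕ) (i : ℤ) : twistedSign (rim n i) = 1 := by
  rcases Int.even_or_odd' i with ⟨m, rfl | rfl⟩
  · rw [rim, altProd_two_mul, altProd_two_mul, sr_zero_mul_sr_one_zpow]
    simp [twistedSign]
  · rw [rim, altProd_two_mul_add_one, altProd_two_mul_add_one, sr_zero_mul_sr_one_zpow]
    simp [twistedSign]

theorem twistedSign_mul_gen_zero {n : ℕ} (x : Equiv.Perm (Fin 3) × DihedralGroup n) :
    twistedSign (x * gen n 0) = -twistedSign x := by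
  obtain ⟨σ, y | y⟩ := x
  · simp [twistedSign, gen, - DihedralGroup.r_zero, DihedralGroup.one_def]
  · simp [twistedSign, gen, - DihedralGroup.r_zero, DihedralGroup.one_def]

/-- Each half is injective by `rim_eq_iff`. The halves are disjoint because `twistedSign` is 1 on
the rim and changes sign along a spoke. -/
theorem rimSpoke_injective {n : ℕ} (hn : n.Coprime 3) : Function.Injective (rimSpoke n) := by
  have hrim : ∀ i j : ZMod (6 * n), rim n i.cast = rim n j.cast → i = j := by
    intro i j h
    rw [rim_eq_iff hn, ← ZMod.intCast_eq_intCast_iff_dvd_sub] at h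
    simpa using h.symm
  have hne : ∀ i j : ZMod (6 * n), rim n i.cast ≠ rim n j.cast * gen n 0 := by
    intro i j h
    have := congrArg twistedSign h
    rw [twistedSign_mul_gen_zero, twistedSign_rim, twistedSign_rim] at this
    exact absurd this (by decide)
  rintro (i | i) (j | j) h
  · exact congrArg _ (hrim i j h)
  · exact absurd h (hne i j)
  · exact absurd h.symm (hne j i)
  · exact congrArg _ (hrim i j (mul_right_cancel h))

/-- The map `rimSpoke` is an isomorphism onto `X n` if the inner edges fit. -/
theorem nonempty_iso_GP {n k : ℕ} [NeZero n] (hn : n.Coprime 3) (hk : Odd k) {a b : Fin 3}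
    (hab : ∀ j : Fin 3, j ≠ 0 → j = a ∨ j = b)
    (hstep : ∀ i : ℤ, rim n (i + k) * gen n 0 =
      rim n i * gen n 0 * gen n (if Even i then a else b)) :
    Nonempty (X n ≃g GP (6 * n) k) := by
  have hG := isInvolutionCayley_X n
  have hinl : ∀ z : ℤ, rimSpoke n (.inl z) = rim n z := rim_cast hn
  have hinr : ∀ z : ℤ, rimSpoke n (.inr z) = rim n z * gen n 0 := fun z => by
    rw [rimSpoke, rim_cast hn]
  -- Since `k` is odd, a shift by `k` changes the parity, so going backwards exchanges `a` and `b`.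
  have hstep' : ∀ i : ℤ, rim n (i - k) * gen n 0 =
      rim n i * gen n 0 * gen n (if Even i then b else a) := by
    intro i
    have h := hstep (i - k)
    rw [sub_add_cancel] at h
    have hpar : Even (i - k) ↔ ¬ Even i := by
      have : ¬ Even (k : ℤ) := by simpa using hk
      rw [Int.even_sub]
      tauto
    rw [h, mul_assoc (_ * _)]
    by_cases hi : Even i <;> simp [hi, hpar, gen_mul_self]
  have hbij : Function.Bijective (rimSpoke n) := by
    rw [Fintype.bijective_iff_injective_and_card]
    refine ⟨rimSpoke_injective hn, ?_⟩
    rw [card_perm_prod_dihedralGroup, Fintype.card_sum, ZMod.card]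
    ring
  have hout : ∀ i : ZMod (6 * n), (X n).Adj (rimSpoke n (.inl i)) (rimSpoke n (.inl (i + 1))) := by
    intro i
    obtain ⟨z, rfl⟩ := ZMod.intCast_surjective i
    have : ((z : ZMod (6 * n)) + 1) = ((z + 1 : ℤ) : ZMod (6 * n)) := by push_cast; rfl
    rw [this, hinl, hinl, rim_add_one]
    exact hG.adj _ _
  have hin : ∀ i : ZMod (6 * n), (X n).Adj (rimSpoke n (.inr i)) (rimSpoke n (.inr (i + k))) := by
    intro i
    obtain ⟨z, rfl⟩ := ZMod.intCast_surjective i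
    have : ((z : ZMod (6 * n)) + k) = ((z + k : ℤ) : ZMod (6 * n)) := by push_cast; rfl
    rw [this, hinr, hinr, hstep]
    exact hG.adj _ _
  have hspoke : ∀ i : ZMod (6 * n), (X n).Adj (rimSpoke n (.inl i)) (rimSpoke n (.inr i)) :=
    fun i => hG.adj _ 0
  -- Every neighbour in X_n is realised by a `GP` neighbour; injectivity then identifies it with the
  -- given one. The proviso `x ≠ y` answers the exclusion of loops in `GP` and is discharged by
  -- adjacency in X_n.
  have hex : ∀ x j, ∃ y, rimSpoke n y = rimSpoke n x * gen n j ∧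
      (x ≠ y → (GP (6 * n) k).Adj x y) := by
    rintro (i | i) j <;> obtain ⟨z, rfl⟩ := ZMod.intCast_surjective i
    · by_cases hj : j = 0
      · exact ⟨.inr z, by rw [hinl, hinr, hj], fun _ => GP_adj_inl_inr.mpr rfl⟩
      by_cases hz : j = if Even z then 1 else 2
      · refine ⟨.inl (z + 1 : ℤ), by rw [hinl, hinl, rim_add_one, hz], fun h =>
          GP_adj_inl_inl.mpr ⟨fun h' => h (congrArg _ h'), Or.inl (by push_cast; rfl)⟩⟩
      · have hz' : j = if Even z then 2 else 1 := by
          split_ifs at hz ⊢ <;> omega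
        refine ⟨.inl (z - 1 : ℤ), by rw [hinl, hinl, rim_sub_one, hz'], fun h =>
          GP_adj_inl_inl.mpr ⟨fun h' => h (congrArg _ h'), Or.inr (by push_cast; ring)⟩⟩
    · by_cases hj : j = 0
      · refine ⟨.inl z, ?_, fun _ => GP_adj_inr_inl.mpr rfl⟩
        rw [hinl, hinr, hj, mul_assoc, gen_mul_self, mul_one]
      by_cases hz : j = if Even z then a else b
      · refine ⟨.inr (z + k : ℤ), by rw [hinr, hinr, hstep, hz], fun h =>
          GP_adj_inr_inr.mpr ⟨fun h' => h (congrArg _ h'), Or.inl (by push_cast; rfl)⟩⟩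
      · have hz' : j = if Even z then b else a := by
          have := hab j hj
          split_ifs at hz ⊢ <;> tauto
        refine ⟨.inr (z - k : ℤ), by rw [hinr, hinr, hstep', hz'], fun h =>
          GP_adj_inr_inr.mpr ⟨fun h' => h (congrArg _ h'), Or.inr (by push_cast; ring)⟩⟩
  refine ⟨Iso.symm ⟨Equiv.ofBijective _ hbij, ?_⟩⟩
  intro x y
  rw [Equiv.ofBijective_apply, Equiv.ofBijective_apply]
  constructor
  · intro h
    obtain ⟨j, hj⟩ := (hG.adj_iff _ _).mp h
    obtain ⟨y', hy', hadj⟩ := hex x j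
    obtain rfl : y' = y := hbij.1 (hy'.trans hj.symm)
    exact hadj fun hxy => h.ne (congrArg _ hxy)
  · intro h
    rcases x with i | i <;> rcases y with j | j
    · rcases (GP_adj_inl_inl.mp h).2 with rfl | rfl
      · exact hout i
      · exact (hout j).symm
    · obtain rfl := GP_adj_inl_inr.mp h
      exact hspoke j
    · obtain rfl := GP_adj_inr_inl.mp h
      exact (hspoke i).symm
    · rcases (GP_adj_inr_inr.mp h).2 with rfl | rfl
      · exact hin i
      · exact (hin j).symm

theorem fst_rim_add_six_mul (n : ℕ) (i t : ℤ) : (rim n (i + 6 * t)).1 = (rim n i).1 := by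
  rw [show i + 6 * t = i + 2 * (3 * t) by ring]
  refine altProd_add_two_mul ?_ i
  rw [zpow_mul, zpow_ofNat, swap_mul_swap_pow_three, one_zpow]

theorem snd_rim_add_two_mul (n : ℕ) (i : ℤ) : (rim n (i + 2 * n)).2 = (rim n i).2 := by
  refine altProd_add_two_mul ?_ i
  simp

/-- Here 2n - 1 is 1 modulo 6 and -1 modulo 2n, so the shift moves the permutation one step forward
and the dihedral part one step back. Conjugation by `swap 0 1` exchanges the other two
transpositions, so past the spoke both components agree with one generator. -/
theorem nonempty_iso_GP_sub_one {n : ℕ} [NeZero n] (hn : n ≡ 1 [MOD 3]) :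
    Nonempty (X n ≃g GP (6 * n) (2 * n - 1)) := by
  have hpos : 0 < n := Nat.pos_of_neZero n
  have h3 : n % 3 = 1 := hn
  have hk : ((2 * n - 1 : ℕ) : ℤ) = 2 * n - 1 := by omega
  refine nonempty_iso_GP (a := 2) (b := 1) ?_ ⟨n - 1, by omega⟩ (by decide) fun i => ?_
  · rw [Nat.coprime_comm, Nat.Prime.coprime_iff_not_dvd Nat.prime_three]
    omega
  obtain ⟨t, ht⟩ : ∃ t : ℤ, (2 * n - 1 : ℤ) = 1 + 6 * t := ⟨(2 * n - 2) / 6, by omega⟩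
  have h1 : (rim n (i + (2 * n - 1 : ℕ))).1 = (rim n (i + 1)).1 := by
    rw [hk, ht, ← add_assoc, fst_rim_add_six_mul]
  have h2 : (rim n (i + (2 * n - 1 : ℕ))).2 = (rim n (i - 1)).2 := by
    rw [hk, show i + (2 * (n : ℤ) - 1) = i - 1 + 2 * n by ring, snd_rim_add_two_mul]
  rw [mul_assoc]
  refine Prod.ext ?_ ?_
  · rw [Prod.fst_mul, h1, rim_add_one, ← Prod.fst_mul, mul_assoc, Prod.fst_mul, Prod.fst_mul]
    congr 1
    split_ifs <;> simp only [Prod.fst_mul, fst_gen] <;> decide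
  · rw [Prod.snd_mul, h2, rim_sub_one, ← Prod.snd_mul, mul_assoc, Prod.snd_mul, Prod.snd_mul]
    congr 1
    split_ifs <;> simp [gen]

/-- As before with the directions exchanged: 2n + 1 is -1 modulo 6 and 1 modulo 2n. -/
theorem nonempty_iso_GP_add_one {n : ℕ} [NeZero n] (hn : n ≡ 2 [MOD 3]) :
    Nonempty (X n ≃g GP (6 * n) (2 * n + 1)) := by
  have h3 : n % 3 = 2 := hn
  have hk : ((2 * n + 1 : ℕ) : ℤ) = 2 * n + 1 := by omega
  refine nonempty_iso_GP (a := 1) (b := 2) ?_ ⟨n, by omega⟩ (by decide) fun i => ?_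
  · rw [Nat.coprime_comm, Nat.Prime.coprime_iff_not_dvd Nat.prime_three]
    omega
  obtain ⟨t, ht⟩ : ∃ t : ℤ, (2 * n + 1 : ℤ) = -1 + 6 * t := ⟨(2 * n + 2) / 6, by omega⟩
  have h1 : (rim n (i + (2 * n + 1 : ℕ))).1 = (rim n (i - 1)).1 := by
    rw [hk, ht, ← add_assoc, fst_rim_add_six_mul, sub_eq_add_neg]
  have h2 : (rim n (i + (2 * n + 1 : ℕ))).2 = (rim n (i + 1)).2 := by
    rw [hk, show i + (2 * (n : ℤ) + 1) = i + 1 + 2 * n by ring, snd_rim_add_two_mul]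
  rw [mul_assoc]
  refine Prod.ext ?_ ?_
  · rw [Prod.fst_mul, h1, rim_sub_one, ← Prod.fst_mul, mul_assoc, Prod.fst_mul, Prod.fst_mul]
    congr 1
    split_ifs <;> simp only [Prod.fst_mul, fst_gen] <;> decide
  · rw [Prod.snd_mul, h2, rim_add_one, ← Prod.snd_mul, mul_assoc, Prod.snd_mul, Prod.snd_mul]
    congr 1
    split_ifs <;> simp [gen]

/-! ### Non-isomorphism with generalized Petersen graphs when 3 ∣ n -/

theorem image_mem_girthCycles {V W : Type*} {G : SimpleGraph V} {H : SimpleGraph W} (φ : G ≃g H)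
    {C : Set (Sym2 V)} (hC : C ∈ girthCycles G) : Sym2.map φ '' C ∈ girthCycles H := by
  obtain ⟨v, p, hp, hl, rfl⟩ := hC
  refine ⟨φ v, p.map φ.toHom, hp.map φ.injective, ?_, ?_⟩
  · rw [Walk.length_map, hl, φ.girth_eq]
  · exact (Walk.edgeSet_map φ.toHom p).symm

theorem girthCycleCount_map {V W : Type*} {G : SimpleGraph V} {H : SimpleGraph W} (φ : G ≃g H)
    (e : Sym2 V) : girthCycleCount H (e.map φ) = girthCycleCount G e := by
  have hinj : Function.Injective (Sym2.map φ) := Sym2.map.injective φ.injective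
  have h : {C ∈ girthCycles H | e.map φ ∈ C} =
      (Sym2.map φ '' ·) '' {C ∈ girthCycles G | e ∈ C} := by
    ext C
    constructor
    · rintro ⟨hC, he⟩
      have hid : ∀ x, Sym2.map φ.symm (Sym2.map φ x) = x := fun x => by
        induction x with | _ a b => simp
      have hid' : ∀ x, Sym2.map φ (Sym2.map φ.symm x) = x := fun x => by
        induction x with | _ a b => simp
      refine ⟨Sym2.map φ.symm '' C, ⟨image_mem_girthCycles φ.symm hC, ⟨_, he, hid e⟩⟩, ?_⟩
      simp [Set.image_image, hid']
    · rintro ⟨C, ⟨hC, he⟩, rfl⟩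
      exact ⟨image_mem_girthCycles φ hC, ⟨e, he, rfl⟩⟩
  rw [girthCycleCount, girthCycleCount, h,
    Set.ncard_image_of_injective _ (Set.image_injective.mpr hinj)]

/-- The rotation of a generalized Petersen graph. -/
def GP.rotation (N k : ℕ) (t : ZMod N) : GP N k ≃g GP N k where
  toEquiv := (Equiv.addRight t).sumCongr (Equiv.addRight t)
  map_rel_iff' {x y} := by
    rcases x with i | i <;> rcases y with j | j
    · simp [GP_adj_inl_inl, add_right_comm _ t 1]
    · simp [GP_adj_inl_inr]
    · simp [GP_adj_inr_inl]
    · simp [GP_adj_inr_inr, add_right_comm _ t (k : ZMod N)]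

theorem girthCycleCount_GP_outer {N k : ℕ} (i : ZMod N) :
    girthCycleCount (GP N k) s(.inl i, .inl (i + 1)) =
      girthCycleCount (GP N k) s(.inl 0, .inl 1) := by
  rw [← girthCycleCount_map (GP.rotation N k i) s(.inl 0, .inl 1)]
  simp [GP.rotation, add_comm]

/-- For `3 ∣ n` the map `D_n → S₃` which sends the dihedral components of the last two generators
to their permutation components. -/
def dihedralToPerm (n : ℕ) : DihedralGroup n → Equiv.Perm (Fin 3)
  | .r i => (Equiv.swap 0 2 * Equiv.swap 1 2) ^ (i.cast : ZMod 3).val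
  | .sr i => Equiv.swap 0 2 * (Equiv.swap 0 2 * Equiv.swap 1 2) ^ (i.cast : ZMod 3).val

/-- As 3 ∣ n, exponents reduce modulo 3 and a check over `ZMod 3` suffices: `h1` and `h2` serve
rotations, `h3` and `h4` reflections. -/
theorem dihedralToPerm_mul_gen {n : ℕ} (hn : 3 ∣ n) (y : DihedralGroup n) {j : Fin 3}
    (hj : j ≠ 0) : dihedralToPerm n (y * (gen n j).2) = dihedralToPerm n y * (gen n j).1 := by
  have h1 : ∀ i : ZMod 3, Equiv.swap 0 2 * (Equiv.swap 0 2 * Equiv.swap 1 2) ^ (-i).val =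
      ((Equiv.swap 0 2 * Equiv.swap 1 2) ^ i.val * Equiv.swap 0 2 : Equiv.Perm (Fin 3)) := by
    decide
  have h2 : ∀ i : ZMod 3, Equiv.swap 0 2 * (Equiv.swap 0 2 * Equiv.swap 1 2) ^ (1 - i).val =
      ((Equiv.swap 0 2 * Equiv.swap 1 2) ^ i.val * Equiv.swap 1 2 : Equiv.Perm (Fin 3)) := by
    decide
  have h3 : ∀ i : ZMod 3, (Equiv.swap 0 2 * Equiv.swap 1 2) ^ (-i).val =
      (Equiv.swap 0 2 * (Equiv.swap 0 2 * Equiv.swap 1 2) ^ i.val * Equiv.swap 0 2 :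
        Equiv.Perm (Fin 3)) := by
    decide
  have h4 : ∀ i : ZMod 3, (Equiv.swap 0 2 * Equiv.swap 1 2) ^ (1 - i).val =
      (Equiv.swap 0 2 * (Equiv.swap 0 2 * Equiv.swap 1 2) ^ i.val * Equiv.swap 1 2 :
        Equiv.Perm (Fin 3)) := by
    decide
  fin_cases j
  · exact absurd rfl hj
  · cases y with
    | r i => simpa [gen, dihedralToPerm, ZMod.cast_neg hn] using h1 i.cast
    | sr i => simpa [gen, dihedralToPerm, ZMod.cast_neg hn] using h3 i.cast
  · cases y with
    | r i =>
      simpa [gen, dihedralToPerm, ZMod.cast_sub hn, ZMod.cast_one hn] using h2 i.cast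
    | sr i =>
      simpa [gen, dihedralToPerm, ZMod.cast_sub hn, ZMod.cast_one hn] using h4 i.cast

/-- If the first generator is distinguished from the others by the number of girth cycles through
its edges, then `X n` with `3 ∣ n` is not a generalized Petersen graph. -/
theorem not_nonempty_iso_GP {n : ℕ} [NeZero n] (hn : 3 ∣ n) {c : Fin 3 → ℕ}
    (hc : ∀ v i, girthCycleCount (X n) s(v, v * gen n i) = c i)
    (hdist : ∀ i j, c i = c j → i ≠ j → i ≠ 0) {N k : ℕ} (hN : N ≠ 0) :
    ¬ Nonempty (X n ≃g GP N k) := by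
  rintro ⟨ψ⟩
  have hG := isInvolutionCayley_X n
  have hpos : 0 < n := Nat.pos_of_neZero n
  have : NeZero N := ⟨hN⟩
  have hcard : N = 6 * n := by
    have := Fintype.card_congr ψ.toEquiv
    rw [card_perm_prod_dihedralGroup, Fintype.card_sum, ZMod.card] at this
    omega
  have htwo : (2 : ZMod N) ≠ 0 := by
    intro h
    have h := (ZMod.natCast_eq_zero_iff 2 N).mp (by exact_mod_cast h)
    have := Nat.le_of_dvd (by norm_num) h
    omega
  have hone : (1 : ZMod N) ≠ 0 := by
    intro h
    apply htwo
    rw [← one_add_one_eq_two, h, add_zero]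
  let x : ZMod N → Equiv.Perm (Fin 3) × DihedralGroup n := fun i => ψ.symm (.inl i)
  have hxinj : Function.Injective x := fun i j h => Sum.inl_injective (ψ.symm.injective h)
  have hadj : ∀ i, ∃ j, x (i + 1) = x i * gen n j := fun i =>
    (hG.adj_iff _ _).mp (ψ.symm.map_adj_iff.mpr
      (GP_adj_inl_inl.mpr ⟨fun h => hone (by simpa using h), Or.inl rfl⟩))
  choose l hl using hadj
  have hcl : ∀ i, c (l i) = girthCycleCount (GP N k) s(.inl 0, .inl 1) := by
    intro i
    rw [← hc (x i), ← hl, ← girthCycleCount_GP_outer i, ← girthCycleCount_map ψ.symm]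
    rfl
  have hl0 : ∀ i, l i ≠ 0 := by
    intro i
    -- Adjacent outer edges have equal counts. Were their labels equal too, the rim would backtrack
    -- and give x (i + 1) = x (i - 1), that is 2 = 0 in `ZMod N`.
    refine hdist (l i) (l (i - 1)) (by rw [hcl, hcl]) fun heq => htwo ?_
    have h := hl (i - 1)
    rw [sub_add_cancel, ← heq] at h
    have h' := hl i
    rw [h, mul_assoc, gen_mul_self, mul_one] at h'
    have := hxinj h'
    linear_combination this
  -- Without the first generator both factors are multiplied by the same permutation at each step,
  -- so this quotient is constant along the rim.
  have hinv : ∀ m : ℕ, (x m).1 * (dihedralToPerm n (x m).2)⁻¹ =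
      (x 0).1 * (dihedralToPerm n (x 0).2)⁻¹ := by
    intro m
    induction m with
    | zero => simp
    | succ m ih =>
      rw [← ih, Nat.cast_succ, hl, Prod.fst_mul, Prod.snd_mul,
        dihedralToPerm_mul_gen hn _ (hl0 _), mul_inv_rev, mul_assoc, mul_inv_cancel_left]
  -- The constant quotient recovers the permutation from the dihedral part, so 6n rim vertices would
  -- inject into a set of size 2n.
  have hsnd : Function.Injective fun i => (x i).2 := by
    intro i j h
    simp only at h
    have hi := hinv i.val
    rw [← hinv j.val, ZMod.natCast_zmod_val, ZMod.natCast_zmod_val, h] at hi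
    exact hxinj (Prod.ext (mul_right_cancel hi) h)
  have hle := Fintype.card_le_of_injective _ hsnd
  rw [ZMod.card, DihedralGroup.card] at hle
  omega

end RainbowGraphs

theorem mainTheorem3 (n : ℕ) [NeZero n] (hn : 3 ≤ n) :
    (RainbowGraphs.X n).Connected ∧
    RainbowGraphs.IsVertexTransitive (RainbowGraphs.X n) ∧
    RainbowGraphs.IsRDR 3 (RainbowGraphs.X n) ∧
    Fintype.card (Equiv.Perm (Fin 3) × DihedralGroup n) = 12 * n ∧
    (n = 3 →
      (RainbowGraphs.X n).girth = 6 ∧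
      RainbowGraphs.HasSignature (RainbowGraphs.X n) [0, 1, 1]) ∧
    (4 ≤ n →
      (RainbowGraphs.X n).girth = 8 ∧
      RainbowGraphs.HasSignature (RainbowGraphs.X n) [5, 5, 6] ∧
      (n ≡ 1 [MOD 3] →
        Nonempty (RainbowGraphs.X n ≃g RainbowGraphs.GP (6 * n) (2 * n - 1))) ∧
      (n ≡ 2 [MOD 3] →
        Nonempty (RainbowGraphs.X n ≃g RainbowGraphs.GP (6 * n) (2 * n + 1)))) ∧
    (3 ∣ n →
      ∀ N k : ℕ, 1 ≤ k → 2 * k ≤ N →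
        ¬ Nonempty (RainbowGraphs.X n ≃g RainbowGraphs.GP N k)) := by
  refine ⟨RainbowGraphs.connected_X n, RainbowGraphs.isVertexTransitive_mulCayley _,
    RainbowGraphs.isRDR_X n, RainbowGraphs.card_perm_prod_dihedralGroup n, ?_, ?_, ?_⟩
  · rintro rfl
    exact ⟨RainbowGraphs.girth_X_three.1, by convert RainbowGraphs.hasSignature_X_three⟩
  · exact fun h4 => ⟨(RainbowGraphs.girth_X_of_four_le h4).1,
      RainbowGraphs.hasSignature_X_of_four_le h4, RainbowGraphs.nonempty_iso_GP_sub_one,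
      RainbowGraphs.nonempty_iso_GP_add_one⟩
  · intro h3 N k hk hkN
    -- In both cases the count of the first generator is isolated: 0 against 1, or 6 against 5.
    rcases hn.eq_or_lt with rfl | h4
    · exact RainbowGraphs.not_nonempty_iso_GP h3 RainbowGraphs.girth_X_three.2 (by decide)
        (by omega)
    · exact RainbowGraphs.not_nonempty_iso_GP h3 (RainbowGraphs.girth_X_of_four_le h4).2
        (by decide) (by omega)
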